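/- Let $n \ge 0$ be an integer, let $H \in \mathbb{R}^{n\times n}$ be symmetric positive semidefinite, let $\gamma > 0$, $g \in \mathbb{R}^n$ and $\theta \in [0,1)$, and set $\kappa = \frac{\|H\|+\gamma}{\gamma}$, where $\|\cdot\|$ denotes the Euclidean norm of vectors and the spectral norm of matrices. (In particular, $g=g_k$, $H=H_k$ and $\gamma=\gamma_k$ may be the gradient, the positive semidefinite model matrix and the regularization parameter at any iteration $k$ of a quadratic regularization method.) Apply the conjugate gradient method, started at $s^{(0)} = 0$ and stopped if its residual vanishes, to the linear system $(H+\gamma I)s = -g$. Then the method computes an iterate $s^{(q)}$ that satisfies the inexactness condition \[ (H+\gamma I)s^{(q)} = -g + t, \qquad \|t\| \le \theta\sqrt{\frac{\gamma}{\|H\|+\gamma}}\;\|g\| \] for some $t \in \mathbb{R}^n$, after a number $q$ of iterations with \[ q \le \min\left\{ n,\ \left\lceil \tfrac12\sqrt{\kappa}\,\log\!\left(\frac{2\kappa}{\theta}\right)\right\rceil \right\}, \] where for $\theta = 0$ the second term is $+\infty$, so that the bound is $n$. These $q$ iterations use exactly $q$ products of a vector with the matrix $H+\gamma I$. -/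

import Mathlib

/-- Programs that access a linear system's matrix only by requesting matrix-vector products:
either stop with an output, or request the product with `v` and continue with the answer. -/
inductive MatVecProg (V α : Type) : Type
  | done (a : α) : MatVecProg V α
  | mul (v : V) (cont : V → MatVecProg V α) : MatVecProg V α

namespace MatVecProg

/-- Sequential composition of programs. -/
def bind {V α β : Type} : MatVecProg V α → (α → MatVecProg V β) → MatVecProg V β
  | done a, f => f a
  | mul v cont, f => mul v (fun w => (cont w).bind f)

/-- The output of a program when products are answered by `A`. -/
def output {V α : Type} (A : V → V) : MatVecProg V α → α
  | done a => a
  | mul v cont => (cont (A v)).output A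

/-- The number of products requested by a program when products are answered by `A`. -/
def products {V α : Type} (A : V → V) : MatVecProg V α → ℕ
  | done _ => 0
  | mul v cont => (cont (A v)).products A + 1

end MatVecProg

/-- The vectors kept by the conjugate gradient method for `A x = b`: the iterate `x`, the
residual `r = A x - b`, and the search direction `p`. -/
structure CGState (n : ℕ) where
  x : EuclideanSpace ℝ (Fin n)
  r : EuclideanSpace ℝ (Fin n)
  p : EuclideanSpace ℝ (Fin n)

/-- Initialization of conjugate gradient for `A x = b` at `x = 0`, so that `r = -b`, `p = -r`. -/
noncomputable def CGState.init {n : ℕ} (b : EuclideanSpace ℝ (Fin n)) : CGState n where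
  x := 0
  r := -b
  p := b

/-- Update of the conjugate gradient state, where `w` is the product `A p`. -/
noncomputable def CGState.update {n : ℕ} (st : CGState n) (w : EuclideanSpace ℝ (Fin n)) :
    CGState n :=
  let α : ℝ := inner ℝ st.r st.r / inner ℝ st.p w
  let r' := st.r + α • w
  let β : ℝ := inner ℝ r' r' / inner ℝ st.r st.r
  { x := st.x + α • st.p
    r := r'
    p := -r' + β • st.p }

open Classical in
/-- One conjugate gradient iteration: nothing more is done once the residual vanishes. -/
noncomputable def cgIteration {n : ℕ} (st : CGState n) :
    MatVecProg (EuclideanSpace ℝ (Fin n)) (CGState n) :=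
  if st.r = 0 then .done st else .mul st.p (fun w => .done (st.update w))

/-- The first `q` iterations of conjugate gradient for `A x = b`, started at zero. -/
noncomputable def conjugateGradient {n : ℕ} (b : EuclideanSpace ℝ (Fin n)) :
    ℕ → MatVecProg (EuclideanSpace ℝ (Fin n)) (CGState n)
  | 0 => .done (CGState.init b)
  | q + 1 => (conjugateGradient b q).bind cgIteration

/-- The spectral norm of a real square matrix. -/
noncomputable def matrixSpectralNorm {n : ℕ} (H : Matrix (Fin n) (Fin n) ℝ) : ℝ :=
  ‖Matrix.toEuclideanCLM (𝕜 := ℝ) H‖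

/-- Multiplication of a vector by `H + γ I`. -/
noncomputable def regularizedMul {n : ℕ} (H : Matrix (Fin n) (Fin n) ℝ) (γ : ℝ)
    (v : EuclideanSpace ℝ (Fin n)) : EuclideanSpace ℝ (Fin n) :=
  Matrix.toEuclideanCLM (𝕜 := ℝ) (H + γ • (1 : Matrix (Fin n) (Fin n) ℝ)) v

/-- The inexactness condition with tolerance `θ` for a step `s`:
`(H + γ I) s = -g + t` with `‖t‖ ≤ θ √(γ / (‖H‖ + γ)) ‖g‖`. -/
def IsInexactStep {n : ℕ} (H : Matrix (Fin n) (Fin n) ℝ) (γ : ℝ)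
    (g : EuclideanSpace ℝ (Fin n)) (θ : ℝ) (s : EuclideanSpace ℝ (Fin n)) : Prop :=
  ∃ t : EuclideanSpace ℝ (Fin n), regularizedMul H γ s = -g + t ∧
    ‖t‖ ≤ θ * Real.sqrt (γ / (matrixSpectralNorm H + γ)) * ‖g‖

/-- The quantity `κ = (‖H‖ + γ) / γ`. -/
noncomputable def kappa {n : ℕ} (H : Matrix (Fin n) (Fin n) ℝ) (γ : ℝ) : ℝ :=
  (matrixSpectralNorm H + γ) / γ

/-!
For a positive definite `A`, the `k`-th conjugate gradient iterate minimizes the energy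
`⟪x - z, A (x - z)⟫` of the error over the Krylov subspace spanned by `b, A b, …, A ^ (k - 1) b`,
where `A z = b`. This energy is therefore at most that of `p(A) z`, for every polynomial `p` of
degree at most `k` with `p(0) = 1`. The normalized characteristic polynomial makes it vanish for
`k = n`. When the spectrum of `A` lies in `[a, c]`, a shifted and normalized Chebyshev polynomial
bounds the relative residual by `2 √κ exp (-2 k / √κ)` with `κ = c / a`. Both iteration bounds hold
for the least `q` whose residual meets the tolerance, and no earlier residual vanishes, so that
every iteration up to `q` uses a product.
-/

namespace MatVecProg

variable {V α β : Type} (A : V → V) (m : MatVecProg V α) (f : α → MatVecProg V β)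

theorem output_bind : (m.bind f).output A = (f (m.output A)).output A := by
  induction m with
  | done a => rfl
  | mul v _ ih => exact ih (A v)

theorem products_bind :
    (m.bind f).products A = m.products A + (f (m.output A)).products A := by
  induction m with
  | done a => exact (Nat.zero_add _).symm
  | mul v _ ih =>
    simp only [bind, products, output, ih]
    omega

end MatVecProg

section Recurrence

variable {n : ℕ}

/-- The state reached by the conjugate gradient method for `A x = b` after `k` iterations. It is
defined for every `k`, and stays constant once the residual vanishes. -/
noncomputable def cgState (A : EuclideanSpace ℝ (Fin n) → EuclideanSpace ℝ (Fin n))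
    (b : EuclideanSpace ℝ (Fin n)) (k : ℕ) : CGState n :=
  (conjugateGradient b k).output A

/-- The step length `α` of the iteration that follows `cgState A b k`. -/
noncomputable def cgStep (A : EuclideanSpace ℝ (Fin n) → EuclideanSpace ℝ (Fin n))
    (b : EuclideanSpace ℝ (Fin n)) (k : ℕ) : ℝ :=
  inner ℝ (cgState A b k).r (cgState A b k).r / inner ℝ (cgState A b k).p (A (cgState A b k).p)

theorem CGState.update_p_eq_zero {st : CGState n} {w : EuclideanSpace ℝ (Fin n)}
    (h : (st.update w).r = 0) : (st.update w).p = 0 := by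
  change -(st.update w).r +
    (inner ℝ (st.update w).r (st.update w).r / inner ℝ st.r st.r : ℝ) • st.p = 0
  rw [h, inner_zero_left, zero_div, zero_smul, neg_zero, add_zero]

theorem CGState.update_of_r_eq_zero {st : CGState n} (hr : st.r = 0) (hp : st.p = 0)
    (w : EuclideanSpace ℝ (Fin n)) : st.update w = st := by
  obtain ⟨x, r, p⟩ := st
  obtain rfl : r = 0 := hr
  obtain rfl : p = 0 := hp
  simp [CGState.update]

variable (A : EuclideanSpace ℝ (Fin n) → EuclideanSpace ℝ (Fin n))
  (b : EuclideanSpace ℝ (Fin n)) {k : ℕ}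

theorem cgState_succ_of_r_eq_zero (h : (cgState A b k).r = 0) :
    cgState A b (k + 1) = cgState A b k := by
  rw [cgState, conjugateGradient, MatVecProg.output_bind, ← cgState, cgIteration, if_pos h,
    MatVecProg.output]

theorem cgState_succ_of_r_ne_zero (h : (cgState A b k).r ≠ 0) :
    cgState A b (k + 1) = (cgState A b k).update (A (cgState A b k).p) := by
  rw [cgState, conjugateGradient, MatVecProg.output_bind, ← cgState, cgIteration, if_neg h,
    MatVecProg.output, MatVecProg.output]

variable {A b} in
theorem cgState_p_eq_zero (h : (cgState A b k).r = 0) : (cgState A b k).p = 0 := by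
  induction k with
  | zero => exact neg_eq_zero.1 h
  | succ k ih =>
    by_cases hk : (cgState A b k).r = 0
    · rw [cgState_succ_of_r_eq_zero A b hk, ih hk]
    · rw [cgState_succ_of_r_ne_zero A b hk] at h ⊢
      exact CGState.update_p_eq_zero h

/-- At a vanishing residual the direction vanishes too, and `0 / 0 = 0` makes the update trivial:
the recurrence needs no stopping test. -/
theorem cgState_succ (k : ℕ) :
    cgState A b (k + 1) = (cgState A b k).update (A (cgState A b k).p) := by
  by_cases h : (cgState A b k).r = 0
  · rw [cgState_succ_of_r_eq_zero A b h, CGState.update_of_r_eq_zero h (cgState_p_eq_zero h)]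
  · exact cgState_succ_of_r_ne_zero A b h

theorem cgState_x_succ (k : ℕ) :
    (cgState A b (k + 1)).x = (cgState A b k).x + cgStep A b k • (cgState A b k).p := by
  rw [cgState_succ, CGState.update, cgStep]

theorem cgState_r_succ (k : ℕ) :
    (cgState A b (k + 1)).r = (cgState A b k).r + cgStep A b k • A (cgState A b k).p := by
  rw [cgState_succ, CGState.update, cgStep]

theorem cgState_p_succ (k : ℕ) :
    (cgState A b (k + 1)).p = -(cgState A b (k + 1)).r +
      (inner ℝ (cgState A b (k + 1)).r (cgState A b (k + 1)).r /
        inner ℝ (cgState A b k).r (cgState A b k).r : ℝ) • (cgState A b k).p := by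
  rw [cgState_succ, CGState.update]

theorem products_conjugateGradient (h : ∀ j < k, (cgState A b j).r ≠ 0) :
    (conjugateGradient b k).products A = k := by
  induction k with
  | zero => rfl
  | succ k ih =>
    rw [conjugateGradient, MatVecProg.products_bind, ih fun j hj => h j (hj.trans k.lt_succ_self),
      ← cgState, cgIteration, if_neg (h k k.lt_succ_self), MatVecProg.products,
      MatVecProg.products]

theorem cgState_r_eq (A : EuclideanSpace ℝ (Fin n) →ₗ[ℝ] EuclideanSpace ℝ (Fin n)) (k : ℕ) :
    (cgState A b k).r = A (cgState A b k).x - b := by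
  induction k with
  | zero =>
    change -b = A 0 - b
    rw [map_zero, zero_sub]
  | succ k ih =>
    rw [cgState_r_succ, cgState_x_succ, ih, map_add, map_smul]
    abel

end Recurrence

section Krylov

variable {R M : Type*} [CommSemiring R] [AddCommMonoid M] [Module R M]

/-- The `k`-th Krylov subspace of `A` and `b`, spanned by `b, A b, …, A ^ (k - 1) b`. -/
def krylovSubspace (A : M →ₗ[R] M) (b : M) (k : ℕ) : Submodule R M :=
  Submodule.span R ((fun i : ℕ => (A ^ i) b) '' Set.Iio k)

theorem aeval_apply_mem_krylovSubspace (A : M →ₗ[R] M) (b : M) {k : ℕ} {p : Polynomial R}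
    (hp : p.degree < k) : Polynomial.aeval A p b ∈ krylovSubspace A b k := by
  rw [Polynomial.aeval_eq_sum_range, LinearMap.sum_apply]
  refine sum_mem fun i _ => ?_
  rw [LinearMap.smul_apply]
  by_cases hi : i < k
  · exact Submodule.smul_mem _ _ (Submodule.subset_span ⟨i, hi, rfl⟩)
  · rw [Polynomial.coeff_eq_zero_of_degree_lt (hp.trans_le (by exact_mod_cast not_lt.1 hi)),
      zero_smul]
    exact Submodule.zero_mem _

theorem aeval_apply_sub_mem_krylovSubspace {R M : Type*} [CommRing R] [Nontrivial R]
    [AddCommGroup M] [Module R M] (A : M →ₗ[R] M) (z : M) {k : ℕ} {p : Polynomial R}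
    (hp : p.natDegree ≤ k) (hp0 : p.eval 0 = 1) :
    z - Polynomial.aeval A p z ∈ krylovSubspace A (A z) k := by
  have hp_ne : p ≠ 0 := fun h => by simp [h] at hp0
  have hsub : z - Polynomial.aeval A p z = -Polynomial.aeval A p.divX (A z) := by
    conv_lhs => rw [← p.divX_mul_X_add, Polynomial.coeff_zero_eq_eval_zero, hp0]
    simp [Module.End.mul_apply]
  rw [hsub]
  refine neg_mem (aeval_apply_mem_krylovSubspace A _ ?_)
  exact (Polynomial.degree_divX_lt hp_ne).trans_le (Polynomial.degree_le_of_natDegree_le hp)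

end Krylov

section Orthogonality

open scoped InnerProductSpace

variable {n : ℕ} (A : EuclideanSpace ℝ (Fin n) →ₗ[ℝ] EuclideanSpace ℝ (Fin n))
  (b : EuclideanSpace ℝ (Fin n))

/-- The span of the first `k` search directions of conjugate gradient. -/
def cgSearchSpace (k : ℕ) : Submodule ℝ (EuclideanSpace ℝ (Fin n)) :=
  Submodule.span ℝ ((fun j => (cgState A b j).p) '' Set.Iio k)

theorem cgSearchSpace_mono : Monotone (cgSearchSpace A b) := fun _ _ h =>
  Submodule.span_mono (Set.image_mono (Set.Iio_subset_Iio h))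

theorem cgSearchSpace_succ (k : ℕ) :
    cgSearchSpace A b (k + 1) = ℝ ∙ (cgState A b k).p ⊔ cgSearchSpace A b k := by
  rw [cgSearchSpace, ← Order.succ_eq_add_one, Order.Iio_succ_eq_insert, Set.image_insert_eq,
    Submodule.span_insert, cgSearchSpace]

theorem cgState_p_mem (k : ℕ) : (cgState A b k).p ∈ cgSearchSpace A b (k + 1) :=
  Submodule.subset_span ⟨k, k.lt_succ_self, rfl⟩

theorem cgState_x_mem (k : ℕ) : (cgState A b k).x ∈ cgSearchSpace A b k := by
  induction k with
  | zero => exact Submodule.zero_mem _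
  | succ k ih =>
    rw [cgState_x_succ]
    exact add_mem (cgSearchSpace_mono A b k.le_succ ih)
      (Submodule.smul_mem _ _ (cgState_p_mem A b k))

theorem cgState_r_mem (k : ℕ) : (cgState A b k).r ∈ cgSearchSpace A b (k + 1) := by
  cases k with
  | zero => exact neg_mem (cgState_p_mem A b 0)
  | succ k =>
    rw [← neg_mem_iff, ← sub_eq_of_eq_add (cgState_p_succ A b k)]
    exact sub_mem (cgState_p_mem A b _) (Submodule.smul_mem _ _
      (cgSearchSpace_mono A b (Nat.le_succ _) (cgState_p_mem A b k)))

variable {A b}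

theorem mem_orthogonal_cgSearchSpace_succ {k : ℕ} {u : EuclideanSpace ℝ (Fin n)} :
    u ∈ (cgSearchSpace A b (k + 1))ᗮ ↔
      ⟪(cgState A b k).p, u⟫_ℝ = 0 ∧ u ∈ (cgSearchSpace A b k)ᗮ := by
  rw [cgSearchSpace_succ, ← Submodule.inf_orthogonal, Submodule.mem_inf,
    Submodule.mem_orthogonal_singleton_iff_inner_right]

theorem inner_cgState_p_r {k : ℕ} (hr : (cgState A b k).r ∈ (cgSearchSpace A b k)ᗮ) :
    ⟪(cgState A b k).p, (cgState A b k).r⟫_ℝ = -⟪(cgState A b k).r, (cgState A b k).r⟫_ℝ := by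
  cases k with
  | zero =>
    change ⟪b, -b⟫_ℝ = -⟪-b, -b⟫_ℝ
    rw [inner_neg_neg, inner_neg_right]
  | succ k =>
    have hp := Submodule.inner_right_of_mem_orthogonal (cgState_p_mem A b k) hr
    conv_lhs => rw [cgState_p_succ]
    rw [inner_add_left, inner_neg_left, inner_smul_left, hp, mul_zero, add_zero]

theorem cgStep_mul_inner_p_map_p (hpos : ∀ v, v ≠ 0 → 0 < ⟪v, A v⟫_ℝ) {k : ℕ}
    (hr : (cgState A b k).r ∈ (cgSearchSpace A b k)ᗮ) :
    cgStep A b k * ⟪(cgState A b k).p, A (cgState A b k).p⟫_ℝ =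
      ⟪(cgState A b k).r, (cgState A b k).r⟫_ℝ := by
  by_cases hp : (cgState A b k).p = 0
  · have hpr := inner_cgState_p_r hr
    rw [hp, inner_zero_left, zero_eq_neg] at hpr
    rw [hp, inner_zero_left, mul_zero, hpr]
  · exact div_mul_cancel₀ _ (hpos _ hp).ne'

theorem cgStep_ne_zero (hpos : ∀ v, v ≠ 0 → 0 < ⟪v, A v⟫_ℝ) {k : ℕ}
    (hr : (cgState A b k).r ∈ (cgSearchSpace A b k)ᗮ) (hk : (cgState A b k).r ≠ 0) :
    cgStep A b k ≠ 0 :=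
  left_ne_zero_of_mul (cgStep_mul_inner_p_map_p hpos hr ▸ inner_self_ne_zero.2 hk)

theorem map_cgState_p_mem (hpos : ∀ v, v ≠ 0 → 0 < ⟪v, A v⟫_ℝ) {k : ℕ}
    (hr : (cgState A b k).r ∈ (cgSearchSpace A b k)ᗮ) :
    A (cgState A b k).p ∈ cgSearchSpace A b (k + 2) := by
  by_cases hk : (cgState A b k).r = 0
  · rw [cgState_p_eq_zero hk, map_zero]
    exact Submodule.zero_mem _
  · rw [← Submodule.smul_mem_iff _ (cgStep_ne_zero hpos hr hk),
      ← sub_eq_of_eq_add' (cgState_r_succ A b k)]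
    exact sub_mem (cgState_r_mem A b _)
      (cgSearchSpace_mono A b (Nat.le_succ _) (cgState_r_mem A b k))

theorem cgState_r_succ_mem_orthogonal (hpos : ∀ v, v ≠ 0 → 0 < ⟪v, A v⟫_ℝ) {k : ℕ}
    (hr : (cgState A b k).r ∈ (cgSearchSpace A b k)ᗮ)
    (hp : A (cgState A b k).p ∈ (cgSearchSpace A b k)ᗮ) :
    (cgState A b (k + 1)).r ∈ (cgSearchSpace A b (k + 1))ᗮ := by
  rw [mem_orthogonal_cgSearchSpace_succ, cgState_r_succ]
  refine ⟨?_, add_mem hr (Submodule.smul_mem _ _ hp)⟩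
  rw [inner_add_right, inner_smul_right, cgStep_mul_inner_p_map_p hpos hr, inner_cgState_p_r hr,
    neg_add_cancel]

theorem inner_map_cgState_p_p_succ (hpos : ∀ v, v ≠ 0 → 0 < ⟪v, A v⟫_ℝ) {k : ℕ}
    (hr : (cgState A b k).r ∈ (cgSearchSpace A b k)ᗮ)
    (hr' : (cgState A b (k + 1)).r ∈ (cgSearchSpace A b (k + 1))ᗮ) :
    ⟪A (cgState A b k).p, (cgState A b (k + 1)).p⟫_ℝ = 0 := by
  by_cases hk : (cgState A b k).r = 0
  · rw [cgState_p_eq_zero hk, map_zero, inner_zero_left]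
  have hmap : cgStep A b k * ⟪A (cgState A b k).p, (cgState A b (k + 1)).r⟫_ℝ =
      ⟪(cgState A b (k + 1)).r, (cgState A b (k + 1)).r⟫_ℝ := by
    rw [← real_inner_smul_left, ← sub_eq_of_eq_add' (cgState_r_succ A b k), inner_sub_left,
      Submodule.inner_right_of_mem_orthogonal (cgState_r_mem A b k) hr', sub_zero]
  have hstep := cgStep_mul_inner_p_map_p hpos hr
  have hrr : ⟪(cgState A b k).r, (cgState A b k).r⟫_ℝ ≠ 0 := inner_self_ne_zero.2 hk
  refine (mul_eq_zero.1 ?_).resolve_left (cgStep_ne_zero hpos hr hk)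
  rw [cgState_p_succ, inner_add_right, inner_neg_right, real_inner_smul_right, mul_add, mul_neg,
    hmap, mul_left_comm, real_inner_comm (cgState A b k).p, hstep, div_mul_cancel₀ _ hrr,
    neg_add_cancel]

theorem map_cgState_p_succ_mem_orthogonal (hA : A.IsSymmetric)
    (hpos : ∀ v, v ≠ 0 → 0 < ⟪v, A v⟫_ℝ) {k : ℕ}
    (hr : (cgState A b k).r ∈ (cgSearchSpace A b k)ᗮ)
    (hp : A (cgState A b k).p ∈ (cgSearchSpace A b k)ᗮ)
    (hmap : ∀ v ∈ cgSearchSpace A b k, A v ∈ cgSearchSpace A b (k + 1)) :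
    A (cgState A b (k + 1)).p ∈ (cgSearchSpace A b (k + 1))ᗮ := by
  have hr' := cgState_r_succ_mem_orthogonal hpos hr hp
  refine mem_orthogonal_cgSearchSpace_succ.2 ⟨?_, (Submodule.mem_orthogonal _ _).2 fun v hv => ?_⟩
  · rw [← hA, inner_map_cgState_p_p_succ hpos hr hr']
  · rw [← hA, cgState_p_succ, inner_add_right, inner_neg_right, inner_smul_right,
      Submodule.inner_right_of_mem_orthogonal (hmap v hv) hr', hA v (cgState A b k).p,
      Submodule.inner_right_of_mem_orthogonal hv hp, mul_zero, neg_zero, add_zero]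

theorem cgState_orthogonality (hA : A.IsSymmetric) (hpos : ∀ v, v ≠ 0 → 0 < ⟪v, A v⟫_ℝ) (k : ℕ) :
    (cgState A b k).r ∈ (cgSearchSpace A b k)ᗮ ∧
    A (cgState A b k).p ∈ (cgSearchSpace A b k)ᗮ ∧
    cgSearchSpace A b k ≤ (cgSearchSpace A b (k + 1)).comap A := by
  induction k with
  | zero => simp [cgSearchSpace]
  | succ k ih =>
    obtain ⟨hr, hp, hmap⟩ := ih
    refine ⟨cgState_r_succ_mem_orthogonal hpos hr hp,
      map_cgState_p_succ_mem_orthogonal hA hpos hr hp hmap, ?_⟩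
    rw [cgSearchSpace_succ, sup_le_iff, Submodule.span_singleton_le_iff_mem]
    exact ⟨map_cgState_p_mem hpos hr,
      hmap.trans (Submodule.comap_mono (cgSearchSpace_mono A b (Nat.le_succ _)))⟩

theorem krylovSubspace_le_cgSearchSpace (hA : A.IsSymmetric)
    (hpos : ∀ v, v ≠ 0 → 0 < ⟪v, A v⟫_ℝ) (k : ℕ) :
    krylovSubspace A b k ≤ cgSearchSpace A b k := by
  have hpow (i : ℕ) : (A ^ i) b ∈ cgSearchSpace A b (i + 1) := by
    induction i with
    | zero => exact cgState_p_mem A b 0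
    | succ i ih =>
      rw [pow_succ', Module.End.mul_apply]
      exact (cgState_orthogonality hA hpos (i + 1)).2.2 ih
  rw [krylovSubspace, Submodule.span_le]
  rintro _ ⟨i, hi, rfl⟩
  exact cgSearchSpace_mono A b hi (hpow i)

end Orthogonality

section Optimality

open scoped InnerProductSpace

/-- Galerkin orthogonality: the energies of `x - z` and `y - x` add up to that of `y - z`. -/
theorem inner_map_sub_le_of_map_sub_mem_orthogonal {E : Type*} [NormedAddCommGroup E]
    [InnerProductSpace ℝ E] {A : E →ₗ[ℝ] E} (hA : A.IsPositive) {W : Submodule ℝ E} {x y z : E}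
    (hx : x ∈ W) (hy : y ∈ W) (hxz : A (x - z) ∈ Wᗮ) :
    ⟪x - z, A (x - z)⟫_ℝ ≤ ⟪y - z, A (y - z)⟫_ℝ := by
  have hyx : ⟪y - x, A (x - z)⟫_ℝ = 0 :=
    Submodule.inner_right_of_mem_orthogonal (sub_mem hy hx) hxz
  have hxy : ⟪x - z, A (y - x)⟫_ℝ = 0 := by rw [← hA.isSymmetric, real_inner_comm, hyx]
  calc ⟪x - z, A (x - z)⟫_ℝ ≤ ⟪x - z, A (x - z)⟫_ℝ + ⟪y - x, A (y - x)⟫_ℝ :=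
        le_add_of_nonneg_right (hA.re_inner_nonneg_right _)
    _ = ⟪(y - x) + (x - z), A ((y - x) + (x - z))⟫_ℝ := by
        rw [map_add, inner_add_left, inner_add_right, inner_add_right, hxy, hyx]
        ring
    _ = ⟪y - z, A (y - z)⟫_ℝ := by rw [sub_add_sub_cancel]

variable {n : ℕ} {A : EuclideanSpace ℝ (Fin n) →ₗ[ℝ] EuclideanSpace ℝ (Fin n)}

theorem cgState_energy_le (hA : A.IsSymmetric) (hpos : ∀ v, v ≠ 0 → 0 < ⟪v, A v⟫_ℝ)
    (z : EuclideanSpace ℝ (Fin n)) {k : ℕ} {p : Polynomial ℝ} (hp : p.natDegree ≤ k)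
    (hp0 : p.eval 0 = 1) :
    ⟪(cgState A (A z) k).x - z, A ((cgState A (A z) k).x - z)⟫_ℝ ≤
      ⟪Polynomial.aeval A p z, A (Polynomial.aeval A p z)⟫_ℝ := by
  have hA' : A.IsPositive := by
    refine ⟨hA, fun v => ?_⟩
    rcases eq_or_ne v 0 with rfl | hv
    · simp
    · exact (hpos v hv).le.trans_eq (real_inner_comm _ _)
  have hres : A ((cgState A (A z) k).x - z) ∈ (cgSearchSpace A (A z) k)ᗮ := by
    rw [map_sub, ← cgState_r_eq]
    exact (cgState_orthogonality hA hpos k).1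
  have hy := krylovSubspace_le_cgSearchSpace hA hpos k
    (aeval_apply_sub_mem_krylovSubspace A z hp hp0)
  have h := inner_map_sub_le_of_map_sub_mem_orthogonal hA' (cgState_x_mem A _ k) hy hres
  rwa [sub_sub_cancel_left, map_neg, inner_neg_neg] at h

theorem surjective_of_forall_inner_map_pos (hpos : ∀ v, v ≠ 0 → 0 < ⟪v, A v⟫_ℝ) :
    Function.Surjective A := by
  refine LinearMap.surjective_of_injective ((injective_iff_map_eq_zero A).2 fun v hv => ?_)
  by_contra h
  simpa [hv] using hpos v h

theorem cgState_r_eq_zero (hA : A.IsSymmetric) (hpos : ∀ v, v ≠ 0 → 0 < ⟪v, A v⟫_ℝ)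
    (b : EuclideanSpace ℝ (Fin n)) : (cgState A b n).r = 0 := by
  obtain ⟨z, rfl⟩ := surjective_of_forall_inner_map_pos hpos b
  have hroot : A.charpoly.eval 0 ≠ 0 := fun h => by
    obtain ⟨v, hv⟩ :=
      ((Module.End.hasEigenvalue_iff_isRoot_charpoly A 0).2 h).exists_hasEigenvector
    simpa [hv.apply_eq_smul] using hpos v hv.2
  have henergy := cgState_energy_le hA hpos z (k := n)
    (p := Polynomial.C (A.charpoly.eval 0)⁻¹ * A.charpoly)
    ((Polynomial.natDegree_C_mul_le _ _).trans
      ((LinearMap.charpoly_natDegree A).trans finrank_euclideanSpace_fin).le) (by simp [hroot])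
  rw [map_mul, LinearMap.aeval_self_charpoly, mul_zero, LinearMap.zero_apply, inner_zero_left]
    at henergy
  have hx : (cgState A (A z) n).x - z = 0 := by
    by_contra h
    exact henergy.not_gt (hpos _ h)
  rw [cgState_r_eq, ← map_sub, hx, map_zero]

end Optimality

section Spectral

open scoped InnerProductSpace
open Polynomial

variable {E : Type*} [NormedAddCommGroup E] [InnerProductSpace ℝ E] {A : E →ₗ[ℝ] E}

theorem isSymmetric_aeval (hA : A.IsSymmetric) (p : ℝ[X]) : (aeval A p).IsSymmetric := by
  rw [aeval_eq_sum_range]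
  exact LinearMap.isSymmetric_sum _ fun i _ => (hA.pow i).smul (conj_trivial _)

theorem norm_map_sq_eq_inner_aeval (hA : A.IsSymmetric) (v : E) :
    ‖A v‖ ^ 2 = ⟪v, aeval A (X ^ 2 : ℝ[X]) v⟫_ℝ := by
  rw [← real_inner_self_eq_norm_sq, hA, aeval_X_pow, sq, Module.End.mul_apply]

variable [FiniteDimensional ℝ E]

theorem inner_aeval_eq_sum_eigenvalues (hA : A.IsSymmetric) (p : ℝ[X]) (v : E) :
    ⟪v, aeval A p v⟫_ℝ =
      ∑ i, p.eval (hA.eigenvalues rfl i) * ⟪hA.eigenvectorBasis rfl i, v⟫_ℝ ^ 2 := by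
  rw [← (hA.eigenvectorBasis rfl).sum_inner_mul_inner]
  refine Finset.sum_congr rfl fun i _ => ?_
  rw [← isSymmetric_aeval hA, Module.End.aeval_apply_of_hasEigenvector
    (hA.hasEigenvector_eigenvectorBasis rfl i), real_inner_smul_left, real_inner_comm,
    RCLike.ofReal_real_eq_id, id, mul_left_comm, ← sq]

theorem inner_aeval_le_inner_aeval (hA : A.IsSymmetric) {p q : ℝ[X]}
    (hpq : ∀ μ ∈ spectrum ℝ A, p.eval μ ≤ q.eval μ) (v : E) :
    ⟪v, aeval A p v⟫_ℝ ≤ ⟪v, aeval A q v⟫_ℝ := by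
  rw [inner_aeval_eq_sum_eigenvalues hA, inner_aeval_eq_sum_eigenvalues hA]
  gcongr with i
  exact hpq _ (hA.hasEigenvalue_eigenvalues rfl i).mem_spectrum

variable {a c : ℝ}

theorem mul_norm_sq_le_inner_map (hA : A.IsSymmetric) (ha : ∀ μ ∈ spectrum ℝ A, a ≤ μ) (v : E) :
    a * ‖v‖ ^ 2 ≤ ⟪v, A v⟫_ℝ := by
  simpa [real_inner_smul_right] using
    inner_aeval_le_inner_aeval hA (p := C a) (q := X) (by simpa using ha) v

theorem inner_map_pos (hA : A.IsSymmetric) (ha : 0 < a) (hspec : ∀ μ ∈ spectrum ℝ A, a ≤ μ) (v : E)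
    (hv : v ≠ 0) : 0 < ⟪v, A v⟫_ℝ :=
  (by positivity : 0 < a * ‖v‖ ^ 2).trans_le (mul_norm_sq_le_inner_map hA hspec v)

theorem mul_inner_map_le_norm_map_sq (hA : A.IsSymmetric)
    (hspec : ∀ μ ∈ spectrum ℝ A, 0 ≤ μ ∧ a ≤ μ) (v : E) : a * ⟪v, A v⟫_ℝ ≤ ‖A v‖ ^ 2 := by
  have h := inner_aeval_le_inner_aeval hA (p := C a * X) (q := X ^ 2) (fun μ hμ => ?_) v
  · simpa [norm_map_sq_eq_inner_aeval hA, real_inner_smul_right] using h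
  · rw [eval_C_mul, eval_X, eval_pow, eval_X, sq]
    exact mul_le_mul_of_nonneg_right (hspec μ hμ).2 (hspec μ hμ).1

theorem norm_map_sq_le_mul_inner_map (hA : A.IsSymmetric)
    (hspec : spectrum ℝ A ⊆ Set.Icc 0 c) (v : E) : ‖A v‖ ^ 2 ≤ c * ⟪v, A v⟫_ℝ := by
  have h := inner_aeval_le_inner_aeval hA (p := X ^ 2) (q := C c * X) (fun μ hμ => ?_) v
  · simpa [norm_map_sq_eq_inner_aeval hA, real_inner_smul_right] using h
  · rw [eval_C_mul, eval_X, eval_pow, eval_X, sq]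
    exact mul_le_mul_of_nonneg_right (hspec hμ).2 (hspec hμ).1

theorem inner_aeval_map_aeval_le (hA : A.IsSymmetric) {p : ℝ[X]} {M : ℝ}
    (hnonneg : ∀ μ ∈ spectrum ℝ A, 0 ≤ μ) (hM : ∀ μ ∈ spectrum ℝ A, |p.eval μ| ≤ M) (v : E) :
    ⟪aeval A p v, A (aeval A p v)⟫_ℝ ≤ M ^ 2 * ⟪v, A v⟫_ℝ := by
  have h := inner_aeval_le_inner_aeval hA (p := p * X * p) (q := M ^ 2 • X) (fun μ hμ => ?_) v
  · simpa [isSymmetric_aeval hA p v, real_inner_smul_right] using h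
  · have hsq : p.eval μ ^ 2 ≤ M ^ 2 := sq_le_sq.2 ((hM μ hμ).trans (le_abs_self M))
    rw [eval_mul, eval_mul, eval_smul, eval_X, smul_eq_mul]
    nlinarith [hnonneg μ hμ]

end Spectral

section ResidualBound

open scoped InnerProductSpace
open Polynomial

variable {n : ℕ} {A : EuclideanSpace ℝ (Fin n) →ₗ[ℝ] EuclideanSpace ℝ (Fin n)} {a c : ℝ}

theorem norm_cgState_r_le (hA : A.IsSymmetric) (ha : 0 < a) (hac : a ≤ c)
    (hspec : spectrum ℝ A ⊆ Set.Icc a c) (b : EuclideanSpace ℝ (Fin n)) {k : ℕ} {p : ℝ[X]}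
    (hp : p.natDegree ≤ k) (hp0 : p.eval 0 = 1) {M : ℝ} (hM0 : 0 ≤ M)
    (hM : ∀ μ ∈ Set.Icc a c, |p.eval μ| ≤ M) :
    ‖(cgState A b k).r‖ ≤ √(c / a) * M * ‖b‖ := by
  have hc : 0 < c := ha.trans_le hac
  have hle (μ : ℝ) (hμ : μ ∈ spectrum ℝ A) : a ≤ μ := (hspec hμ).1
  have hnonneg (μ : ℝ) (hμ : μ ∈ spectrum ℝ A) : 0 ≤ μ := ha.le.trans (hle μ hμ)
  have hpos := inner_map_pos hA ha hle
  obtain ⟨z, rfl⟩ := surjective_of_forall_inner_map_pos hpos b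
  refine le_of_sq_le_sq ?_ (by positivity)
  calc ‖(cgState A (A z) k).r‖ ^ 2
      = ‖A ((cgState A (A z) k).x - z)‖ ^ 2 := by rw [map_sub, cgState_r_eq]
    _ ≤ c * ⟪(cgState A (A z) k).x - z, A ((cgState A (A z) k).x - z)⟫_ℝ :=
        norm_map_sq_le_mul_inner_map hA (hspec.trans (Set.Icc_subset_Icc_left ha.le)) _
    _ ≤ c * ⟪aeval A p z, A (aeval A p z)⟫_ℝ := by gcongr; exact cgState_energy_le hA hpos z hp hp0
    _ ≤ c * (M ^ 2 * ⟪z, A z⟫_ℝ) := by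
        gcongr
        exact inner_aeval_map_aeval_le hA hnonneg (fun μ hμ => hM μ (hspec hμ)) z
    _ = c / a * M ^ 2 * (a * ⟪z, A z⟫_ℝ) := by field_simp
    _ ≤ c / a * M ^ 2 * ‖A z‖ ^ 2 := by
        gcongr
        exact mul_inner_map_le_norm_map_sq hA (fun μ hμ => ⟨hnonneg μ hμ, hle μ hμ⟩) z
    _ = (√(c / a) * M * ‖A z‖) ^ 2 := by
        rw [mul_pow, mul_pow, Real.sq_sqrt (by positivity)]

end ResidualBound

section Chebyshev

open Polynomial

theorem two_div_le_log_div {s : ℝ} (hs : 1 < s) : 2 / s ≤ Real.log ((s + 1) / (s - 1)) := by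
  have hs' : 0 < s - 1 := sub_pos.2 hs
  convert Real.le_log_one_add_of_nonneg (x := 2 / (s - 1)) (by positivity) using 1
  · field_simp
    ring
  · congr 1
    field_simp
    ring

theorem cosh_log_div {s : ℝ} (hs : 1 < s) :
    Real.cosh (Real.log ((s + 1) / (s - 1))) = (s ^ 2 + 1) / (s ^ 2 - 1) := by
  have hs1 : 0 < s - 1 := sub_pos.2 hs
  have hs2 : 0 < s + 1 := by linarith
  rw [Real.cosh_log (div_pos hs2 hs1), inv_div, show s ^ 2 - 1 = (s + 1) * (s - 1) by ring]
  field_simp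
  ring

theorem half_exp_le_cosh (x : ℝ) : Real.exp x / 2 ≤ Real.cosh x := by
  rw [Real.cosh_eq]
  linarith [Real.exp_pos (-x)]

theorem half_exp_le_eval_chebyshevT {s : ℝ} (hs : 1 < s) (k : ℕ) :
    Real.exp (2 * k / s) / 2 ≤ (Chebyshev.T ℝ k).eval ((s ^ 2 + 1) / (s ^ 2 - 1)) := by
  rw [← cosh_log_div hs, Chebyshev.T_real_cosh, Int.cast_natCast]
  refine le_trans ?_ (half_exp_le_cosh _)
  gcongr
  calc 2 * (k : ℝ) / s = k * (2 / s) := by ring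
    _ ≤ k * Real.log ((s + 1) / (s - 1)) := by
        gcongr
        exact two_div_le_log_div hs

/-- The Chebyshev polynomial `T k` transported to the interval `[a, c]`, for `a < c`. The affine
change of variables reverses orientation, which keeps the value at `0` positive. -/
noncomputable def shiftedChebyshev (a c : ℝ) (k : ℕ) : ℝ[X] :=
  (Chebyshev.T ℝ k).comp (C ((c + a) / (c - a)) - C (2 / (c - a)) * X)

theorem natDegree_shiftedChebyshev_le (a c : ℝ) (k : ℕ) :
    (shiftedChebyshev a c k).natDegree ≤ k := by
  have haffine : (C ((c + a) / (c - a)) - C (2 / (c - a)) * X : ℝ[X]).natDegree ≤ 1 := by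
    compute_degree
  refine natDegree_comp_le.trans ?_
  rw [Chebyshev.natDegree_T, Int.natAbs_natCast]
  exact mul_le_of_le_one_right k.zero_le haffine

theorem abs_eval_shiftedChebyshev_le_one {a c x : ℝ} (hac : a < c) (hx : x ∈ Set.Icc a c)
    (k : ℕ) : |(shiftedChebyshev a c k).eval x| ≤ 1 := by
  have hca : 0 < c - a := sub_pos.2 hac
  simp only [shiftedChebyshev, eval_comp, eval_sub, eval_C, eval_mul, eval_X]
  refine Chebyshev.abs_eval_T_real_le_one _ ?_
  rw [div_mul_eq_mul_div, ← sub_div, abs_div, abs_of_pos hca, div_le_one hca, abs_le]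
  constructor <;> linarith [hx.1, hx.2]

theorem half_exp_le_eval_zero_shiftedChebyshev {a c : ℝ} (ha : 0 < a) (hac : a < c) (k : ℕ) :
    Real.exp (2 * k / √(c / a)) / 2 ≤ (shiftedChebyshev a c k).eval 0 := by
  have hs : 1 < √(c / a) := by rwa [Real.lt_sqrt zero_le_one, one_pow, one_lt_div ha]
  have hsq : (√(c / a) ^ 2 + 1) / (√(c / a) ^ 2 - 1) = (c + a) / (c - a) := by
    rw [Real.sq_sqrt (div_pos (ha.trans hac) ha).le, div_add_one ha.ne', div_sub_one ha.ne',
      div_div_div_cancel_right₀ ha.ne']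
  simpa only [shiftedChebyshev, eval_comp, eval_sub, eval_C, eval_mul, eval_X, mul_zero, sub_zero,
    hsq] using half_exp_le_eval_chebyshevT hs k

theorem exists_polynomial_abs_eval_le {a c : ℝ} (ha : 0 < a) (hac : a ≤ c) (k : ℕ) :
    ∃ p : ℝ[X], p.natDegree ≤ k ∧ p.eval 0 = 1 ∧
      ∀ x ∈ Set.Icc a c, |p.eval x| ≤ 2 * Real.exp (-(2 * k / √(c / a))) := by
  rcases hac.eq_or_lt with rfl | hac
  · refine ⟨(1 - C a⁻¹ * X) ^ k, ?_, by simp, fun x hx => ?_⟩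
    · exact natDegree_pow_le_of_le k (by compute_degree) |>.trans_eq (mul_one k)
    · obtain rfl : x = a := le_antisymm hx.2 hx.1
      rcases k with - | k
      · simp
      · simp [ha.ne', Real.exp_nonneg]
  · have hexp := half_exp_le_eval_zero_shiftedChebyshev ha hac k
    have hpos : 0 < (shiftedChebyshev a c k).eval 0 := hexp.trans_lt' (by positivity)
    refine ⟨C ((shiftedChebyshev a c k).eval 0)⁻¹ * shiftedChebyshev a c k,
      (natDegree_C_mul_le _ _).trans (natDegree_shiftedChebyshev_le a c k), ?_, fun x hx => ?_⟩
    · rw [eval_C_mul, inv_mul_cancel₀ hpos.ne']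
    · rw [eval_C_mul, abs_mul, abs_of_pos (inv_pos.2 hpos)]
      calc _ ≤ (Real.exp (2 * k / √(c / a)) / 2)⁻¹ * 1 := by
            gcongr
            exact abs_eval_shiftedChebyshev_le_one hac hx k
        _ = 2 * Real.exp (-(2 * k / √(c / a))) := by
            rw [mul_one, inv_div, Real.exp_neg, div_eq_mul_inv]

theorem mul_two_mul_exp_le {s ε k : ℝ} (hs : 0 < s) (hε : 0 < ε)
    (hk : 1 / 2 * s * Real.log (2 * s / ε) ≤ k) : s * (2 * Real.exp (-(2 * k / s))) ≤ ε := by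
  have hlog : Real.log (2 * s / ε) ≤ 2 * k / s := by
    rw [le_div_iff₀ hs]
    linarith
  calc s * (2 * Real.exp (-(2 * k / s))) ≤ s * (2 * Real.exp (-Real.log (2 * s / ε))) := by gcongr
    _ = ε := by
      rw [Real.exp_neg, Real.exp_log (by positivity), inv_div]
      field_simp

end Chebyshev

section IterationCount

variable {n : ℕ} {A : EuclideanSpace ℝ (Fin n) →ₗ[ℝ] EuclideanSpace ℝ (Fin n)} {a c : ℝ}

theorem norm_cgState_r_le_exp (hA : A.IsSymmetric) (ha : 0 < a) (hac : a ≤ c)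
    (hspec : spectrum ℝ A ⊆ Set.Icc a c) (b : EuclideanSpace ℝ (Fin n)) (k : ℕ) :
    ‖(cgState A b k).r‖ ≤ √(c / a) * (2 * Real.exp (-(2 * k / √(c / a)))) * ‖b‖ := by
  obtain ⟨p, hp, hp0, hpM⟩ := exists_polynomial_abs_eval_le ha hac k
  exact norm_cgState_r_le hA ha hac hspec b hp hp0 (by positivity) hpM

theorem exists_norm_cgState_r_le (hA : A.IsSymmetric) (ha : 0 < a) (hac : a ≤ c)
    (hspec : spectrum ℝ A ⊆ Set.Icc a c) (b : EuclideanSpace ℝ (Fin n)) {ε : ℝ} (hε : 0 ≤ ε) :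
    ∃ q : ℕ, ‖(cgState A b q).r‖ ≤ ε * ‖b‖ ∧
      (conjugateGradient b q).products A = q ∧
      q ≤ n ∧
      (0 < ε → q ≤ ⌈1 / 2 * √(c / a) * Real.log (2 * √(c / a) / ε)⌉₊) := by
  classical
  have hn : ‖(cgState A b n).r‖ ≤ ε * ‖b‖ := by
    rw [cgState_r_eq_zero hA (inner_map_pos hA ha fun μ hμ => (hspec hμ).1), norm_zero]
    positivity
  have hex : ∃ q, ‖(cgState A b q).r‖ ≤ ε * ‖b‖ := ⟨n, hn⟩
  refine ⟨Nat.find hex, Nat.find_spec hex, products_conjugateGradient A b fun j hj hr => ?_,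
    Nat.find_min' hex hn, fun hε' => Nat.find_min' hex ?_⟩
  · refine Nat.find_min hex hj ?_
    rw [hr, norm_zero]
    positivity
  · refine (norm_cgState_r_le_exp hA ha hac hspec b _).trans ?_
    gcongr
    exact mul_two_mul_exp_le (Real.sqrt_pos.2 (div_pos (ha.trans_le hac) ha)) hε' (Nat.le_ceil _)

end IterationCount

section Regularized

variable {n : ℕ} {H : Matrix (Fin n) (Fin n) ℝ} {γ : ℝ}

theorem isSymmetric_regularized (hH : H.IsHermitian) :
    (Matrix.toEuclideanLin (𝕜 := ℝ) (H + γ • (1 : Matrix (Fin n) (Fin n) ℝ))).IsSymmetric :=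
  Matrix.isSymmetric_toEuclideanLin_iff.2
    (hH.add (Matrix.isHermitian_one.smul (star_trivial γ)))

theorem spectrum_subset_Icc (hH : H.PosSemidef) :
    spectrum ℝ H ⊆ Set.Icc 0 (matrixSpectralNorm H) := by
  intro μ hμ
  refine ⟨(Matrix.posSemidef_iff_isHermitian_and_spectrum_nonneg.1 hH).2 hμ, ?_⟩
  rw [← AlgEquiv.spectrum_eq (Matrix.toEuclideanCLM (n := Fin n) (𝕜 := ℝ)) H] at hμ
  calc μ ≤ ‖μ‖ := le_abs_self μ
    _ ≤ ‖Matrix.toEuclideanCLM (𝕜 := ℝ) H‖ * ‖(1 : EuclideanSpace ℝ (Fin n) →L[ℝ] _)‖ :=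
        spectrum.norm_le_norm_mul_of_mem hμ
    _ ≤ matrixSpectralNorm H :=
        mul_le_of_le_one_right (norm_nonneg _) ContinuousLinearMap.norm_id_le

theorem spectrum_regularized_subset_Icc (hH : H.PosSemidef) :
    spectrum ℝ (Matrix.toEuclideanLin (𝕜 := ℝ) (H + γ • (1 : Matrix (Fin n) (Fin n) ℝ))) ⊆
      Set.Icc γ (matrixSpectralNorm H + γ) := by
  rw [Matrix.spectrum_toLpLin, ← Algebra.algebraMap_eq_smul_one, ← spectrum.add_singleton_eq,
    Set.add_singleton, Set.image_subset_iff, Set.preimage_add_const_Icc, sub_self,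
    add_sub_cancel_right]
  exact spectrum_subset_Icc hH

theorem isInexactStep_iff {g s : EuclideanSpace ℝ (Fin n)} {θ : ℝ} :
    IsInexactStep H γ g θ s ↔
      ‖regularizedMul H γ s - -g‖ ≤ θ * √(γ / (matrixSpectralNorm H + γ)) * ‖-g‖ := by
  rw [IsInexactStep, norm_neg]
  constructor
  · rintro ⟨t, ht, hle⟩
    rwa [ht, add_sub_cancel_left]
  · exact fun h => ⟨_, (add_sub_cancel _ _).symm, h⟩

theorem two_mul_sqrt_div_mul_sqrt_inv {x : ℝ} (hx : 0 ≤ x) (θ : ℝ) :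
    2 * √x / (θ * √x⁻¹) = 2 * x / θ := by
  rw [Real.sqrt_inv, ← div_eq_mul_inv, div_div_eq_mul_div, mul_assoc, Real.mul_self_sqrt hx]

end Regularized

theorem proposition1_general (n : ℕ) (H : Matrix (Fin n) (Fin n) ℝ) (hH : H.PosSemidef)
    (γ : ℝ) (hγ : 0 < γ) (g : EuclideanSpace ℝ (Fin n))
    (θ : ℝ) (hθ : 0 ≤ θ) :
    ∃ q : ℕ,
      IsInexactStep H γ g θ ((conjugateGradient (-g) q).output (regularizedMul H γ)).x ∧
      (conjugateGradient (-g) q).products (regularizedMul H γ) = q ∧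
      q ≤ n ∧
      (0 < θ →
        q ≤ ⌈(1 / 2 : ℝ) * Real.sqrt (kappa H γ) * Real.log (2 * kappa H γ / θ)⌉₊) := by
  have hnorm : 0 ≤ matrixSpectralNorm H := norm_nonneg _
  have hκ : 0 < kappa H γ := div_pos (add_pos_of_nonneg_of_pos hnorm hγ) hγ
  have hκ_def : (matrixSpectralNorm H + γ) / γ = kappa H γ := rfl
  have hκ_inv : γ / (matrixSpectralNorm H + γ) = (kappa H γ)⁻¹ := (inv_div _ _).symm
  obtain ⟨q, hres, hprod, hqn, hqκ⟩ := exists_norm_cgState_r_le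
    (isSymmetric_regularized hH.isHermitian) hγ (le_add_of_nonneg_left hnorm)
    (spectrum_regularized_subset_Icc hH) (-g)
    (ε := θ * √(γ / (matrixSpectralNorm H + γ))) (by positivity)
  refine ⟨q, isInexactStep_iff.2 (cgState_r_eq (-g) _ q ▸ hres), hprod, hqn, fun hθ' => ?_⟩
  rw [hκ_def, hκ_inv, two_mul_sqrt_div_mul_sqrt_inv hκ.le] at hqκ
  exact hqκ (by positivity)

theorem proposition1 (n : ℕ) (H : Matrix (Fin n) (Fin n) ℝ) (hH : H.PosSemidef)
    (γ : ℝ) (hγ : 0 < γ) (g : EuclideanSpace ℝ (Fin n))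
    (θ : ℝ) (hθ0 : 0 ≤ θ) (hθ1 : θ < 1) :
    ∃ q : ℕ,
      IsInexactStep H γ g θ ((conjugateGradient (-g) q).output (regularizedMul H γ)).x ∧
      (conjugateGradient (-g) q).products (regularizedMul H γ) = q ∧
      q ≤ n ∧
      (0 < θ →
        q ≤ ⌈(1 / 2 : ℝ) * Real.sqrt (kappa H γ) * Real.log (2 * kappa H γ / θ)⌉₊) :=
  proposition1_general n H hH γ hγ g θ hθ0
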